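/- Let $T$ be a theory in a countable first-order language $L$. Let $\mathcal U\models T$ be a monster model, i.e. $\mathcal U$ is $\bar\kappa$-saturated and strongly $\bar\kappa$-homogeneous (every partial elementary map between subsets of size $<\bar\kappa$ extends to an automorphism) for some cardinal $\bar\kappa>\aleph_0$, and let $M\prec\mathcal U$ be a countable model. Let $x,y$ be finite tuples of variables and let $\phi(x;y)$ be an $L$-formula which is NIP: there is no infinite set $A$ of $|x|$-tuples of $\mathcal U$ together with, for each $I\subseteq A$, a $|y|$-tuple $b_I$ of $\mathcal U$ such that for all $a\in A$, $\mathcal U\models\phi(a;b_I)\iff a\in I$. Let $S_\phi(\mathcal U)$ be the space of global $\phi$-types, i.e. of finitely satisfiable sets $p$ of formulas of the form $\phi(x;b)$ or $\neg\phi(x;b)$ with $b\in\mathcal U^{|y|}$ that contain, for each such $b$, one of $\phi(x;b)$ and $\neg\phi(x;b)$; its topology is generated by the sets $\{p : \psi\in p\}$, with $\psi$ an instance $\phi(x;b)$ or $\neg\phi(x;b)$. Let $\mathrm{Inv}_\phi(M)\subseteq S_\phi(\mathcal U)$ be the subspace of $M$-invariant $\phi$-types, i.e. of those fixed by every automorphism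 of $\mathcal U$ that fixes $M$ pointwise. Then for every closed subset $F\subseteq\mathrm{Inv}_\phi(M)$, the set of $G_\delta$ points of $F$ (points $p\in F$ such that $\{p\}$ is the intersection of at most countably many relatively open subsets of $F$) is dense in $F$. -/

import Mathlib

open FirstOrder Cardinal

universe u v w

namespace PhiTypes

variable {L : FirstOrder.Language.{u, v}} {U : Type w} [L.Structure U] {m n : ℕ}

section Monster

variable (L U)

/-- `U` is `κ`-saturated: every set of formulas in finitely many variables, with parameters in a
subset `A ⊆ U` of size `< κ`, that is finitely satisfiable in `U` is realized in `U`. -/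
def IsSaturated (κ : Cardinal.{w}) : Prop :=
  ∀ A : Set U, #A < κ → ∀ (k : ℕ) (S : Set (L[[A]].Formula (Fin k))),
    (∀ s : Finset (L[[A]].Formula (Fin k)), (s : Set (L[[A]].Formula (Fin k))) ⊆ S →
      ∃ c : Fin k → U, ∀ ψ ∈ s, ψ.Realize c) →
    ∃ c : Fin k → U, ∀ ψ ∈ S, ψ.Realize c

/-- `U` is strongly `κ`-homogeneous: every partial elementary map from a subset of `U` of
size `< κ` to `U` extends to an automorphism of `U`. -/
def IsStronglyHomogeneous (κ : Cardinal.{w}) : Prop :=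
  ∀ A : Set U, #A < κ → ∀ f : A → U,
    (∀ (k : ℕ) (ψ : L.Formula (Fin k)) (c : Fin k → A),
      ψ.Realize (fun i => f (c i)) ↔ ψ.Realize (fun i => (c i : U))) →
    ∃ σ : U ≃[L] U, ∀ a : A, σ a = f a

/-- `U` is a monster model with respect to cardinals below `κ`. -/
structure IsMonster (κ : Cardinal.{w}) : Prop where
  saturated : IsSaturated L U κ
  homogeneous : IsStronglyHomogeneous L U κ

end Monster

/-- The formula `φ(x; y)` is NIP (in `U`): there is no infinite set `A` of `x`-tuples such that
every subset of `A` is cut out on `A` by an instance `φ(x; b)`. -/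
def IsNIP (U : Type w) [L.Structure U] (φ : L.Formula (Fin m ⊕ Fin n)) : Prop :=
  ¬ ∃ A : Set (Fin m → U), A.Infinite ∧ ∀ I ⊆ A, ∃ b : Fin n → U,
    ∀ a ∈ A, (φ.Realize (Sum.elim a b) ↔ a ∈ I)

/-- The instance `φ(x; b)`, a formula in the variables `x` with parameters in `U`. -/
noncomputable def inst (φ : L.Formula (Fin m ⊕ Fin n)) (b : Fin n → U) :
    L[[U]].Formula (Fin m) :=
  FirstOrder.Language.BoundedFormula.constantsVarsEquiv.symm
    (φ.relabel (Sum.elim Sum.inr (fun j => Sum.inl (b j)) : Fin m ⊕ Fin n → U ⊕ Fin m))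

theorem realize_inst (φ : L.Formula (Fin m ⊕ Fin n)) (b : Fin n → U) (a : Fin m → U) :
    (inst φ b).Realize a ↔ φ.Realize (Sum.elim a b) := by
  unfold inst FirstOrder.Language.Formula.Realize
  rw [← FirstOrder.Language.BoundedFormula.realize_constantsVarsEquiv, Equiv.apply_symm_apply]
  change (FirstOrder.Language.Formula.relabel _ φ).Realize _ ↔ _
  rw [FirstOrder.Language.Formula.realize_relabel]
  unfold FirstOrder.Language.Formula.Realize
  have : (Sum.elim (fun a : U => ((L.con a : L[[U]].Constants) : U)) a ∘
      (Sum.elim Sum.inr (fun j => Sum.inl (b j)) : Fin m ⊕ Fin n → U ⊕ Fin m)) =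
      Sum.elim a b := by
    funext i
    rcases i with i | i
    · simp
    · simp only [Function.comp_apply, Sum.elim_inr, Sum.elim_inl]
      rfl
  rw [this]

/-- A global (complete) `φ`-type: a set of instances `φ(x; b)` and negated instances
`¬ φ(x; b)`, `b` in `U`, that is finitely satisfiable in `U` (i.e. consistent with the
elementary diagram of `U`) and decides `φ(x; b)` for every `b`. -/
@[ext]
structure GlobalType (U : Type w) [L.Structure U] (φ : L.Formula (Fin m ⊕ Fin n)) where
  formulas : Set (L[[U]].Formula (Fin m))
  isInstance : ∀ ψ ∈ formulas, ∃ b : Fin n → U, ψ = inst φ b ∨ ψ = ∼(inst φ b)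
  finSat : ∀ s : Finset (L[[U]].Formula (Fin m)),
    (s : Set (L[[U]].Formula (Fin m))) ⊆ formulas → ∃ a : Fin m → U, ∀ ψ ∈ s, ψ.Realize a
  complete : ∀ b : Fin n → U, inst φ b ∈ formulas ∨ ∼(inst φ b) ∈ formulas

/-- The usual topology on the space `S_φ(U)` of global `φ`-types, generated by the sets of types
containing a given formula. -/
instance instTopologicalSpaceGlobalType (φ : L.Formula (Fin m ⊕ Fin n)) : TopologicalSpace (GlobalType U φ) :=
  TopologicalSpace.generateFrom
    (Set.range fun ψ : L[[U]].Formula (Fin m) => {p : GlobalType U φ | ψ ∈ p.formulas})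

/-- `p` is `M`-invariant: it is fixed by every automorphism of `U` fixing `M` pointwise. -/
def GlobalType.IsInvariant {φ : L.Formula (Fin m ⊕ Fin n)} (p : GlobalType U φ)
    (M : L.ElementarySubstructure U) : Prop :=
  ∀ σ : U ≃[L] U, (∀ a ∈ M, σ a = a) → ∀ b : Fin n → U,
    (inst φ b ∈ p.formulas ↔ inst φ (fun j => σ (b j)) ∈ p.formulas)

/-- The space `Inv_φ(M)` of global `M`-invariant `φ`-types, a subspace of `S_φ(U)`. -/
abbrev Inv (φ : L.Formula (Fin m ⊕ Fin n)) (M : L.ElementarySubstructure U) : Type _ :=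
  {p : GlobalType U φ // p.IsInvariant M}

end PhiTypes

open FirstOrder.Language Set

/-! View an `M`-invariant `p` as the two-valued function sending `b` to the truth value of `φ(x; b)
∈ p`. By homogeneity it depends only on the type of `b` over `M`, and there are only countably many
`M`-definable sets.

NIP gives `GlobalType.IsInvariant.exists_constant`: on every nonempty `C`, `p` is constant on `D ∩
C` for some `M`-definable `D` meeting `C`. Otherwise `p` takes both values on all such `D ∩ C`, and
realizing `p` over countably many suitable parameters, again and again, builds an infinite shattered
set.

The rest is topology (`exists_isGδ_singleton`): in a compact space of such functions, a closed `Gδ`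
set is shrunk countably often until its members can no longer differ. Nonempty closed `Gδ` sets
survive countable decreasing intersections, so the remaining point is `Gδ`. -/

namespace PhiTypes

/-! ### Compact spaces of two-valued functions -/

section Topology

variable {K X : Type*} [TopologicalSpace K]

/-- Nonempty closed `Gδ` sets. -/
def IsNonemptyClosedGδ (s : Set K) : Prop := IsClosed s ∧ IsGδ s ∧ s.Nonempty

/-- In a compact space, countably many hereditary properties, each of which can be achieved by
shrinking, can be achieved simultaneously on a nonempty closed `Gδ` set. -/
theorem IsNonemptyClosedGδ.exists_fusion [CompactSpace K] {s : Set K}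
    (hs : IsNonemptyClosedGδ s) (R : ℕ → Set K → Prop)
    (hR : ∀ n t t', t' ⊆ t → R n t → R n t')
    (hstep : ∀ n, ∀ t ⊆ s, IsNonemptyClosedGδ t → ∃ t' ⊆ t, IsNonemptyClosedGδ t' ∧ R n t') :
    ∃ t ⊆ s, IsNonemptyClosedGδ t ∧ ∀ n, R n t := by
  choose g hgs hg hgR using hstep
  let S : ℕ → {t : Set K // t ⊆ s ∧ IsNonemptyClosedGδ t} := fun n =>
    Nat.rec ⟨s, Subset.rfl, hs⟩
      (fun k t => ⟨g k t.1 t.2.1 t.2.2, (hgs k _ _ _).trans t.2.1, hg k _ _ _⟩) n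
  have hsucc : ∀ n, (S (n + 1)).1 ⊆ (S n).1 := fun n => hgs n _ _ _
  refine ⟨⋂ n, (S n).1, iInter_subset (fun n => (S n).1) 0, ⟨?_, ?_, ?_⟩, fun n => ?_⟩
  · exact isClosed_iInter fun n => (S n).2.2.1
  · exact IsGδ.iInter fun n => (S n).2.2.2.1
  · exact IsCompact.nonempty_iInter_of_sequence_nonempty_isCompact_isClosed _ hsucc
      (fun n => (S n).2.2.2.2) (S 0).2.2.1.isCompact (fun n => (S n).2.2.1)
  · exact hR n (S (n + 1)).1 _ (iInter_subset (fun n => (S n).1) (n + 1)) (hgR n _ _ _)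

theorem IsNonemptyClosedGδ.inter_isClopen {s t : Set K} (hs : IsNonemptyClosedGδ s)
    (ht : IsClopen t) (h : (s ∩ t).Nonempty) : IsNonemptyClosedGδ (s ∩ t) :=
  ⟨hs.1.inter ht.1, hs.2.1.inter ht.2.isGδ, h⟩

/-- All elements of `s` agree on `C`. -/
def AgreeOn (e : K → X → Prop) (s : Set K) (C : Set X) : Prop :=
  ∀ f ∈ s, ∀ g ∈ s, ∀ x ∈ C, e f x → e g x

omit [TopologicalSpace K] in
theorem AgreeOn.mono {e : K → X → Prop} {s t : Set K} {C D : Set X} (h : AgreeOn e s C)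
    (hst : t ⊆ s) (hCD : D ⊆ C) : AgreeOn e t D :=
  fun f hf g hg x hx => h f (hst hf) g (hst hg) x (hCD hx)

/-- If no such `t` existed, every smaller closed `Gδ` set would still be split on each `V i ∩ C`.
Fusion would then produce a single function taking both values on every nonempty `V i ∩ C`, against
`hV`. -/
theorem exists_agreeOn_inter [CompactSpace K] {e : K → X → Prop}
    (he : ∀ x, IsClopen {f | e f x}) (V : ℕ → Set X) {C : Set X}
    (hV : ∀ f, ∃ i, (V i ∩ C).Nonempty ∧ ∀ x ∈ V i ∩ C, ∀ y ∈ V i ∩ C, e f x → e f y)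
    {s : Set K} (hs : IsNonemptyClosedGδ s) :
    ∃ t ⊆ s, IsNonemptyClosedGδ t ∧ ∃ i, (V i ∩ C).Nonempty ∧ AgreeOn e t (V i ∩ C) := by
  by_contra hneg
  have hsplit : ∀ t ⊆ s, IsNonemptyClosedGδ t → ∀ i, (V i ∩ C).Nonempty →
      ∃ x ∈ V i ∩ C, ∃ f ∈ t, ∃ g ∈ t, e f x ∧ ¬ e g x := by
    intro t hts ht i hi
    by_contra hcon
    refine hneg ⟨t, hts, ht, i, hi, fun f hf g hg x hx hfx => ?_⟩
    by_contra hgx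
    exact hcon ⟨x, hx, f, hf, g, hg, hfx, hgx⟩
  obtain ⟨t, -, ht, hR⟩ := hs.exists_fusion
    (fun n t => (V n ∩ C).Nonempty →
      ∃ x ∈ V n ∩ C, ∃ y ∈ V n ∩ C, ∀ f ∈ t, e f x ∧ ¬ e f y)
    (fun n t t' htt' h hne => by
      obtain ⟨x, hx, y, hy, hxy⟩ := h hne
      exact ⟨x, hx, y, hy, fun f hf => hxy f (htt' hf)⟩)
    (fun n t hts ht => by
      by_cases hne : (V n ∩ C).Nonempty
      · obtain ⟨x, hx, f, hf, -, -, hfx, -⟩ := hsplit t hts ht n hne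
        have ht' := ht.inter_isClopen (he x) ⟨f, hf, hfx⟩
        -- The set on which `x` is already forced true splits again, which gives a `y` to force
        -- false.
        obtain ⟨y, hy, -, -, g, hg, -, hgy⟩ :=
          hsplit _ (inter_subset_left.trans hts) ht' n hne
        exact ⟨_, inter_subset_left.trans inter_subset_left,
          ht'.inter_isClopen (he y).compl ⟨g, hg, hgy⟩,
          fun _ => ⟨x, hx, y, hy, fun h hh => ⟨hh.1.2, hh.2⟩⟩⟩
      · exact ⟨t, Subset.rfl, ht, fun h => absurd h hne⟩)
  obtain ⟨f, hf⟩ := ht.2.2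
  obtain ⟨i, hi, hconst⟩ := hV f
  obtain ⟨x, hx, y, hy, hxy⟩ := hR i hi
  exact (hxy f hf).2 (hconst x hx y hy (hxy f hf).1)

/-- A compact space of two-valued functions, each of which has on every nonempty set a point of
continuity with respect to a fixed countable family of open sets, has a `Gδ` point in each
nonempty closed `Gδ` set. -/
theorem exists_isGδ_singleton [CompactSpace K] {e : K → X → Prop} (hinj : Function.Injective e)
    (he : ∀ x, IsClopen {f | e f x}) (V : ℕ → Set X)
    (hV : ∀ f, ∀ C : Set X, C.Nonempty →
      ∃ i, (V i ∩ C).Nonempty ∧ ∀ x ∈ V i ∩ C, ∀ y ∈ V i ∩ C, e f x → e f y)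
    {s : Set K} (hs : IsNonemptyClosedGδ s) : ∃ f ∈ s, IsGδ {f} := by
  obtain ⟨t, hts, ht, hR⟩ := hs.exists_fusion
    (fun n t => AgreeOn e t (V n) ∨ ∀ t' ⊆ t, IsNonemptyClosedGδ t' → ¬ AgreeOn e t' (V n))
    (fun n t t' htt' h => h.imp (fun h => h.mono htt' Subset.rfl)
      fun h t'' ht'' => h t'' (ht''.trans htt'))
    (fun n t _ ht => by
      by_cases h : ∃ t' ⊆ t, IsNonemptyClosedGδ t' ∧ AgreeOn e t' (V n)
      · obtain ⟨t', htt', ht', hag⟩ := h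
        exact ⟨t', htt', ht', Or.inl hag⟩
      · exact ⟨t, Subset.rfl, ht, Or.inr fun t' h1 h2 h3 => h ⟨t', h1, h2, h3⟩⟩)
  have hagree : ∀ f ∈ t, ∀ g ∈ t, ∀ x, e f x → e g x := by
    by_contra! hcon
    -- `C` is where members of `t` differ. Agreement on `V i ∩ C` is thus agreement on `V i`, so by
    -- the choice of `t` all of `t` already agrees on `V i`, which meets `C`.
    let C : Set X := {x | ∃ f ∈ t, ∃ g ∈ t, e f x ∧ ¬ e g x}
    have hC : C.Nonempty := by
      obtain ⟨f, hf, g, hg, x, h⟩ := hcon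
      exact ⟨x, f, hf, g, hg, h⟩
    obtain ⟨t', ht't, ht', i, ⟨x, hxi, f, hf, g, hg, hfx, hgx⟩, hag⟩ :=
      exists_agreeOn_inter he V (fun f => hV f C hC) ht
    have hag' : AgreeOn e t' (V i) := by
      intro f hf g hg x hx hfx
      by_contra hgx
      exact hgx (hag f hf g hg x ⟨hx, f, ht't hf, g, ht't hg, hfx, hgx⟩ hfx)
    rcases hR i with h | h
    · exact hgx (h f hf g hg x hxi hfx)
    · exact h t' ht't ht' hag'
  obtain ⟨f, hf⟩ := ht.2.2
  have htf : t = {f} := Subset.antisymm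
    (fun g hg => hinj (funext fun x => propext ⟨hagree g hg f hf x, hagree f hf g hg x⟩))
    (singleton_subset_iff.2 hf)
  exact ⟨f, hts hf, htf ▸ ht.2.1⟩

theorem dense_isGδ_singleton [CompactSpace K] {e : K → X → Prop} (hinj : Function.Injective e)
    (he : ∀ x, IsClopen {f | e f x}) (V : ℕ → Set X)
    (hV : ∀ f, ∀ C : Set X, C.Nonempty →
      ∃ i, (V i ∩ C).Nonempty ∧ ∀ x ∈ V i ∩ C, ∀ y ∈ V i ∩ C, e f x → e f y) :
    Dense {f : K | IsGδ {f}} := by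
  have hsep : ∀ f g : K, f ≠ g → ∃ W : Set K, IsClopen W ∧ f ∈ W ∧ g ∉ W := by
    intro f g hfg
    obtain ⟨x, hx⟩ := Function.ne_iff.1 (hinj.ne hfg)
    by_cases hfx : e f x
    · exact ⟨_, he x, hfx, fun hgx => hx (propext ⟨fun _ => hgx, fun _ => hfx⟩)⟩
    · exact ⟨_, (he x).compl, hfx, fun hgx => hx (propext
        ⟨fun h => absurd h hfx, fun h => absurd h hgx⟩)⟩
  have : TotallySeparatedSpace K := ⟨fun f _ g _ hfg => by
    obtain ⟨W, hW, hfW, hgW⟩ := hsep f g hfg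
    exact ⟨W, Wᶜ, hW.isOpen, hW.compl.isOpen, hfW, hgW, by simp, disjoint_compl_right⟩⟩
  refine dense_iff_inter_open.2 fun O hO ⟨f, hf⟩ => ?_
  obtain ⟨W, hW, hfW, hWO⟩ := compact_exists_isClopen_in_isOpen hO hf
  obtain ⟨g, hg, hgδ⟩ := exists_isGδ_singleton hinj he V hV
    (s := W) ⟨hW.isClosed, hW.isOpen.isGδ, f, hfW⟩
  exact ⟨g, hWO hg, hgδ⟩

end Topology

/-! ### Compactness of the space of invariant types -/

section Compactness

variable {L : FirstOrder.Language.{u, v}} {U : Type w} [L.Structure U] {m n : ℕ}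
  {φ : L.Formula (Fin m ⊕ Fin n)} {M : L.ElementarySubstructure U}

theorem GlobalType.not_inst_mem_iff (p : GlobalType U φ) (b : Fin n → U) :
    ∼(inst φ b) ∈ p.formulas ↔ inst φ b ∉ p.formulas := by
  classical
  refine ⟨fun h h' => ?_, (p.complete b).resolve_left⟩
  obtain ⟨a, ha⟩ := p.finSat {inst φ b, ∼(inst φ b)} (by simp [insert_subset_iff, h, h'])
  exact Formula.realize_not.1 (ha (∼(inst φ b)) (by simp)) (ha (inst φ b) (by simp))

theorem GlobalType.isClopen_inst_mem (b : Fin n → U) :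
    IsClopen {p : GlobalType U φ | inst φ b ∈ p.formulas} := by
  have hopen : ∀ ψ : L[[U]].Formula (Fin m), IsOpen {p : GlobalType U φ | ψ ∈ p.formulas} :=
    fun ψ => TopologicalSpace.isOpen_generateFrom_of_mem ⟨ψ, rfl⟩
  refine ⟨⟨?_⟩, hopen _⟩
  convert hopen (∼(inst φ b)) using 1
  ext p
  exact (p.not_inst_mem_iff b).symm

theorem GlobalType.ext_inst {p q : GlobalType U φ}
    (h : ∀ b : Fin n → U, inst φ b ∈ p.formulas ↔ inst φ b ∈ q.formulas) : p = q := by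
  have key : ∀ {p q : GlobalType U φ},
      (∀ b : Fin n → U, inst φ b ∈ p.formulas ↔ inst φ b ∈ q.formulas) →
      p.formulas ⊆ q.formulas := by
    intro p q h ψ hψ
    obtain ⟨b, rfl | rfl⟩ := p.isInstance ψ hψ
    · exact (h b).1 hψ
    · exact (q.not_inst_mem_iff b).2 fun hb => (p.not_inst_mem_iff b).1 hψ ((h b).2 hb)
  exact GlobalType.ext (Subset.antisymm (key h) (key fun b => (h b).symm))

/-- The limit of an ultrafilter of global `φ`-types. -/
def GlobalType.ultrafilterLim (𝒰 : Ultrafilter (GlobalType U φ)) : GlobalType U φ where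
  formulas := {ψ | ∀ᶠ q : GlobalType U φ in (𝒰 : Filter (GlobalType U φ)), ψ ∈ q.formulas}
  isInstance ψ hψ := by
    obtain ⟨q, hq⟩ := Filter.Eventually.exists hψ
    exact q.isInstance ψ hq
  finSat s hs := by
    have h : ∀ᶠ q : GlobalType U φ in (𝒰 : Filter (GlobalType U φ)), ∀ ψ ∈ s, ψ ∈ q.formulas :=
      (Filter.eventually_all_finset s).2 fun ψ hψ => hs hψ
    obtain ⟨q, hq⟩ := h.exists
    exact q.finSat s hq
  complete b := Ultrafilter.eventually_or.1 (Filter.Eventually.of_forall fun q => q.complete b)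

instance : CompactSpace (GlobalType U φ) := by
  refine ⟨isCompact_iff_ultrafilter_le_nhds.2 fun 𝒰 _ =>
    ⟨GlobalType.ultrafilterLim 𝒰, mem_univ _, ?_⟩⟩
  refine TopologicalSpace.tendsto_nhds_generateFrom_iff (m := id).2 ?_
  rintro _ ⟨ψ, rfl⟩ hψ
  exact hψ

theorem GlobalType.isClosed_isInvariant :
    IsClosed {p : GlobalType U φ | p.IsInvariant M} := by
  simp only [GlobalType.IsInvariant, ofPred_forall]
  refine isClosed_iInter fun σ => isClosed_iInter fun _ => isClosed_iInter fun b => ?_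
  have h1 := GlobalType.isClopen_inst_mem (φ := φ) b
  have h2 := GlobalType.isClopen_inst_mem (φ := φ) (fun j => σ (b j))
  convert ((h1.compl.union h2).inter (h2.compl.union h1)).isClosed using 1
  ext p
  simp only [mem_ofPred_eq, mem_inter_iff, mem_union, mem_compl_iff]
  tauto

instance : CompactSpace (Inv φ M) :=
  isCompact_iff_compactSpace.1 GlobalType.isClosed_isInvariant.isCompact

end Compactness

/-! ### Saturation, homogeneity and the use of NIP -/

section ModelTheory

variable {L : FirstOrder.Language.{u, v}} {U : Type w} [L.Structure U] {m n : ℕ}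

theorem definable_setOf_realize_sumElim {α β : Type*} (ψ : L.Formula (α ⊕ β)) (v : α → U) :
    (range v).Definable L {w : β → U | ψ.Realize (Sum.elim v w)} := by
  refine definable_iff_exists_formula_sum.2
    ⟨ψ.relabel (Sum.map (rangeFactorization v) id), ?_⟩
  ext w
  simp only [mem_ofPred_eq, Formula.realize_relabel]
  refine iff_of_eq (congrArg _ (funext fun i => ?_))
  rcases i with i | i <;> rfl

variable {κ : Cardinal.{w}}

theorem IsSaturated.exists_forall_mem (hU : IsSaturated L U κ) (hκ : ℵ₀ < κ) {A : Set U}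
    (hA : A.Countable) {ι : Type*} {k : ℕ} {P : ι → Set (Fin k → U)}
    (hP : ∀ i, A.Definable L (P i)) (hfin : ∀ s : Finset ι, ∃ c, ∀ i ∈ s, c ∈ P i) :
    ∃ c, ∀ i, c ∈ P i := by
  classical
  choose ψ hψ using hP
  obtain ⟨c, hc⟩ := hU A ((mk_le_aleph0_iff.2 hA.to_subtype).trans_lt hκ) k (range ψ) (by
    intro s hs
    choose g hg using fun χ : s => hs χ.2
    obtain ⟨c, hc⟩ := hfin (Finset.univ.image g)
    refine ⟨c, fun χ hχ => ?_⟩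
    have := hc _ (Finset.mem_image_of_mem g (Finset.mem_univ ⟨χ, hχ⟩))
    rwa [hψ, hg] at this)
  exact ⟨c, fun i => by rw [hψ i]; exact hc _ ⟨i, rfl⟩⟩

theorem IsStronglyHomogeneous.exists_equiv (hU : IsStronglyHomogeneous L U κ) (hκ : ℵ₀ < κ)
    {β : Type*} [Countable β] {v v' : β → U}
    (h : ∀ ψ : L.Formula β, ψ.Realize v ↔ ψ.Realize v') : ∃ σ : U ≃[L] U, ∀ i, σ (v i) = v' i := by
  have hinj : ∀ i j, v i = v j → v' i = v' j := by
    intro i j hij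
    have := h ((Term.var i).equal (Term.var j))
    simp only [Formula.realize_equal, Term.realize_var] at this
    exact this.1 hij
  obtain ⟨σ, hσ⟩ := hU (range v)
    ((mk_le_aleph0_iff.2 (countable_range v).to_subtype).trans_lt hκ)
    (fun a => v' (rangeSplitting v a)) (by
      intro k ψ c
      have := h (ψ.relabel (rangeSplitting v ∘ c))
      rw [Formula.realize_relabel, Formula.realize_relabel] at this
      have hc : v ∘ rangeSplitting v ∘ c = fun i => (c i : U) :=
        funext fun i => apply_rangeSplitting v (c i)
      rw [hc] at this
      exact this.symm)
  refine ⟨σ, fun i => ?_⟩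
  have := hσ ⟨v i, i, rfl⟩
  exact this.trans (hinj _ _ (apply_rangeSplitting v _))

variable {φ : L.Formula (Fin m ⊕ Fin n)} {M : L.ElementarySubstructure U}

/-- The set of `n`-tuples defined by a formula with parameters in `M`. -/
def defSet (M : L.ElementarySubstructure U) (ψ : L.Formula (M ⊕ Fin n)) : Set (Fin n → U) :=
  {b | ψ.Realize (Sum.elim Subtype.val b)}

/-- The set of `b` such that `φ(a; b)` has the truth value of `a ∈ I`. -/
def patternSet (φ : L.Formula (Fin m ⊕ Fin n)) (I : Set (Fin m → U)) (a : Fin m → U) :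
    Set (Fin n → U) :=
  {b | φ.Realize (Sum.elim a b) ↔ a ∈ I}

theorem definable_patternSet (φ : L.Formula (Fin m ⊕ Fin n)) (I : Set (Fin m → U))
    (a : Fin m → U) : (range a).Definable L (patternSet φ I a) := by
  have h := definable_setOf_realize_sumElim φ a
  by_cases ha : a ∈ I
  · simpa only [patternSet, ha, iff_true] using h
  · simp only [patternSet, ha, iff_false]
    exact h.compl

/-- An `M`-invariant type does not distinguish tuples with the same type over `M`. -/
theorem inst_mem_iff_of_forall_defSet (hU : IsMonster L U κ) (hκ : ℵ₀ < κ) [Countable M]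
    {p : GlobalType U φ} (hp : p.IsInvariant M) {b c : Fin n → U}
    (h : ∀ ψ, b ∈ defSet M ψ ↔ c ∈ defSet M ψ) :
    inst φ b ∈ p.formulas ↔ inst φ c ∈ p.formulas := by
  obtain ⟨σ, hσ⟩ := hU.homogeneous.exists_equiv hκ (v := Sum.elim (Subtype.val : M → U) b)
    (v' := Sum.elim Subtype.val c) h
  have := hp σ (fun a ha => hσ (Sum.inl ⟨a, ha⟩)) b
  rwa [show (fun j => σ (b j)) = c from funext fun j => hσ (Sum.inr j)] at this

theorem GlobalType.exists_realize_iff (hU : IsMonster L U κ) (hκ : ℵ₀ < κ) (p : GlobalType U φ)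
    {B : Set (Fin n → U)} (hB : B.Countable) :
    ∃ a : Fin m → U, ∀ b ∈ B, (φ.Realize (Sum.elim a b) ↔ inst φ b ∈ p.formulas) := by
  classical
  obtain ⟨a, ha⟩ := hU.saturated.exists_forall_mem hκ (A := ⋃ b ∈ B, range b) (k := m)
    (hB.biUnion fun b _ => countable_range b)
    (P := fun b : B => {a | φ.Realize (Sum.elim a b.1) ↔ inst φ b.1 ∈ p.formulas})
    (by
      rintro ⟨b, hb⟩
      have h := (definable_setOf_realize_sumElim (φ.relabel Sum.swap) b).mono
        (subset_biUnion_of_mem (u := fun b => range b) hb)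
      have hswap : ∀ a : Fin m → U, Sum.elim b a ∘ Sum.swap = Sum.elim a b := fun a =>
        funext fun i => by rcases i with i | i <;> rfl
      simp only [Formula.realize_relabel, hswap] at h
      by_cases hp : inst φ b ∈ p.formulas
      · simpa only [hp, iff_true] using h
      · simp only [hp, iff_false]
        exact h.compl)
    (by
      intro s
      obtain ⟨a, ha⟩ := p.finSat
        (s.image fun b => if inst φ b.1 ∈ p.formulas then inst φ b.1 else ∼(inst φ b.1)) (by
          intro ψ hψ
          obtain ⟨b, -, rfl⟩ := Finset.mem_image.1 (Finset.mem_coe.1 hψ)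
          split_ifs with h
          · exact h
          · exact (p.not_inst_mem_iff _).2 h)
      refine ⟨a, fun b hb => ?_⟩
      have := ha _ (Finset.mem_image_of_mem _ hb)
      split_ifs at this with h
      · exact iff_of_true ((realize_inst φ b.1 a).1 this) h
      · exact iff_of_false (fun h' => Formula.realize_not.1 this ((realize_inst φ b.1 a).2 h')) h)
  exact ⟨a, fun b hb => ha ⟨b, hb⟩⟩

/-- Every subset of `s` is cut out by an instance of `φ` in every `M`-definable set meeting `C`. -/
def ShatteredNear (φ : L.Formula (Fin m ⊕ Fin n)) (M : L.ElementarySubstructure U)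
    (C : Set (Fin n → U)) (s : Set (Fin m → U)) : Prop :=
  ∀ ψ, (defSet M ψ ∩ C).Nonempty → ∀ I : Set (Fin m → U),
    ∃ b ∈ defSet M ψ, ∀ a ∈ s, b ∈ patternSet φ I a

theorem ShatteredNear.exists_forall_defSet_iff (hU : IsMonster L U κ) (hκ : ℵ₀ < κ) [Countable M]
    {C : Set (Fin n → U)} {s : Set (Fin m → U)} (hs : ShatteredNear φ M C s) (hsc : s.Countable)
    {c : Fin n → U} (hc : c ∈ C) (I : Set (Fin m → U)) :
    ∃ b, (∀ ψ, c ∈ defSet M ψ ↔ b ∈ defSet M ψ) ∧ ∀ a ∈ s, b ∈ patternSet φ I a := by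
  classical
  let P : {ψ // c ∈ defSet M ψ} ⊕ s → Set (Fin n → U) :=
    Sum.elim (fun ψ => defSet M ψ.1) (fun a => patternSet φ I a.1)
  obtain ⟨b, hb⟩ := hU.saturated.exists_forall_mem hκ (P := P)
    (A := range (Subtype.val : M → U) ∪ ⋃ a ∈ s, range a)
    ((countable_range _).union (hsc.biUnion fun a _ => countable_range a))
    (by
      rintro (ψ | a)
      · exact (definable_setOf_realize_sumElim ψ.1 _).mono subset_union_left
      · exact (definable_patternSet φ I a.1).mono
          ((subset_biUnion_of_mem (u := fun a => range a) a.2).trans subset_union_right))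
    (by
      intro t
      -- Finitely many conditions over `M` form one `M`-definable set containing `c`, so `hs`
      -- applies.
      have hconj : ∀ x, x ∈ defSet M (Formula.iInf (fun ψ : t.toLeft => ψ.1.1)) ↔
          ∀ ψ : t.toLeft, x ∈ defSet M ψ.1.1 := fun x => Formula.realize_iInf
      obtain ⟨b, hb, hbI⟩ := hs _ ⟨c, (hconj c).2 fun ψ => ψ.1.2, hc⟩ I
      rw [hconj] at hb
      refine ⟨b, ?_⟩
      rintro (ψ | a) hi
      · exact hb ⟨ψ, Finset.mem_toLeft.2 hi⟩
      · exact hbI a.1 a.2)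
  refine ⟨b, fun ψ => ⟨fun h => hb (Sum.inl ⟨ψ, h⟩), fun h => ?_⟩, fun a ha => hb (Sum.inr ⟨a, ha⟩)⟩
  by_contra hcψ
  have hn : c ∈ defSet M ψ.not := hcψ
  exact (hb (Sum.inl ⟨ψ.not, hn⟩) : b ∈ defSet M ψ.not) h

/-- A witness for a pattern on `s` can be moved to have the type over `M` of a point of `C` where
`p` has a prescribed value; by invariance it has that value too. A realization of `p` over all these
witnesses is the new point. -/
theorem ShatteredNear.exists_insert (hU : IsMonster L U κ) (hκ : ℵ₀ < κ) [Countable M]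
    [Countable (L.Formula (M ⊕ Fin n))] {C : Set (Fin n → U)} (hC : C.Nonempty)
    {p : GlobalType U φ} (hp : p.IsInvariant M)
    (hosc : ∀ ψ, (defSet M ψ ∩ C).Nonempty → ∃ x ∈ defSet M ψ ∩ C, ∃ y ∈ defSet M ψ ∩ C,
      inst φ x ∈ p.formulas ∧ inst φ y ∉ p.formulas)
    {s : Set (Fin m → U)} (hsf : s.Finite) (hs : ShatteredNear φ M C s) :
    ∃ a ∉ s, ShatteredNear φ M C (insert a s) := by
  have hw : ∀ ψ, (defSet M ψ ∩ C).Nonempty → ∀ (I : Set (Fin m → U)) (t : Prop),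
      ∃ b ∈ defSet M ψ, (∀ a ∈ s, b ∈ patternSet φ I a) ∧ (inst φ b ∈ p.formulas ↔ t) := by
    intro ψ hψ I t
    obtain ⟨x, hx, y, hy, hxp, hyp⟩ := hosc ψ hψ
    obtain ⟨c, hc, hct⟩ : ∃ c ∈ defSet M ψ ∩ C, (inst φ c ∈ p.formulas ↔ t) := by
      by_cases ht : t
      · exact ⟨x, hx, iff_of_true hxp ht⟩
      · exact ⟨y, hy, iff_of_false hyp ht⟩
    obtain ⟨b, hcb, hb⟩ := hs.exists_forall_defSet_iff hU hκ hsf.countable hc.2 I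
    exact ⟨b, (hcb ψ).1 hc.1, hb, (inst_mem_iff_of_forall_defSet hU hκ hp hcb).symm.trans hct⟩
  choose g hg hgs hgp using hw
  have : Countable {I // I ⊆ s} := hsf.finite_subsets.countable.to_subtype
  obtain ⟨a, ha⟩ := p.exists_realize_iff hU hκ (countable_range
    fun i : {ψ // (defSet M ψ ∩ C).Nonempty} × {I // I ⊆ s} × Prop =>
      g i.1.1 i.1.2 i.2.1.1 i.2.2)
  have ha' : ∀ ψ hψ I t, I ⊆ s → (φ.Realize (Sum.elim a (g ψ hψ I t)) ↔ t) :=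
    fun ψ hψ I t hI => (ha _ ⟨(⟨ψ, hψ⟩, ⟨I, hI⟩, t), rfl⟩).trans (hgp ψ hψ I t)
  -- `a ∉ s`: a witness for the empty pattern on `s` with `p`-value true gives `φ` at `a` but
  -- nowhere on `s`.
  refine ⟨a, fun has => ?_, fun ψ hψ I => ?_⟩
  · have htop : (defSet M (⊤ : L.Formula (M ⊕ Fin n)) ∩ C).Nonempty := by
      obtain ⟨c, hc⟩ := hC
      exact ⟨c, Formula.realize_top.2 trivial, hc⟩
    have h := hgs ⊤ htop ∅ True a has
    simp only [patternSet, mem_ofPred_eq, mem_empty_iff_false, iff_false] at h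
    exact h ((ha' ⊤ htop ∅ True (empty_subset s)).2 trivial)
  -- Only `I ∩ s` and the truth of `a ∈ I` matter, so countably many witnesses suffice.
  · refine ⟨g ψ hψ (I ∩ s) (a ∈ I), hg _ _ _ _, ?_⟩
    rintro a' (rfl | ha's)
    · exact ha' ψ hψ _ _ inter_subset_right
    · have := hgs ψ hψ (I ∩ s) (a ∈ I) a' ha's
      simpa only [patternSet, mem_ofPred_eq, mem_inter_iff, ha's, and_true] using this

/-- If `φ` is NIP, then every `M`-invariant `φ`-type is constant on some nonempty relatively
`M`-definable subset of each nonempty set of parameters. -/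
theorem GlobalType.IsInvariant.exists_constant (hU : IsMonster L U κ) (hκ : ℵ₀ < κ) [Countable M]
    [Countable (L.Formula (M ⊕ Fin n))] (hφ : IsNIP U φ) {p : GlobalType U φ}
    (hp : p.IsInvariant M) {C : Set (Fin n → U)} (hC : C.Nonempty) :
    ∃ ψ, (defSet M ψ ∩ C).Nonempty ∧ ∀ x ∈ defSet M ψ ∩ C, ∀ y ∈ defSet M ψ ∩ C,
      inst φ x ∈ p.formulas → inst φ y ∈ p.formulas := by
  by_contra! hosc
  have hstep : ∀ s : {s : Set (Fin m → U) // s.Finite ∧ ShatteredNear φ M C s},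
      ∃ t : {s : Set (Fin m → U) // s.Finite ∧ ShatteredNear φ M C s}, s.1 ⊂ t.1 := by
    rintro ⟨s, hsf, hs⟩
    obtain ⟨a, has, ha⟩ := hs.exists_insert hU hκ hC hp hosc hsf
    exact ⟨⟨insert a s, hsf.insert a, ha⟩, ssubset_insert has⟩
  choose next hnext using hstep
  have h0 : ShatteredNear φ M C ∅ := fun ψ hψ I => by
    obtain ⟨b, hb⟩ := hψ
    exact ⟨b, hb.1, by simp⟩
  let S : ℕ → {s : Set (Fin m → U) // s.Finite ∧ ShatteredNear φ M C s} := fun k =>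
    Nat.rec ⟨∅, finite_empty, h0⟩ (fun _ s => next s) k
  have hS : StrictMono fun k => (S k).1 := strictMono_nat_of_lt_succ fun k => hnext (S k)
  have hcount : (⋃ k, (S k).1).Countable := countable_iUnion fun k => (S k).2.1.countable
  refine hφ ⟨⋃ k, (S k).1, fun hfin => ?_, fun I _ => ?_⟩
  · exact infinite_range_of_injective hS.injective
      (hfin.finite_subsets.subset (range_subset_iff.2 fun k => subset_iUnion (fun k => (S k).1) k))
  · obtain ⟨b, hb⟩ := hU.saturated.exists_forall_mem hκ
      (A := ⋃ a ∈ ⋃ k, (S k).1, range a) (hcount.biUnion fun a _ => countable_range a)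
      (P := fun a : ↥(⋃ k, (S k).1) => patternSet φ I a.1)
      (fun a => (definable_patternSet φ I a.1).mono
        (subset_biUnion_of_mem (u := fun a => range a) a.2))
      (by
        intro t
        -- Finitely many points lie in a single stage of the increasing chain.
        have ht : ∃ k, ∀ a ∈ t, a.1 ∈ (S k).1 := by
          choose r hr using fun a : ↥(⋃ k, (S k).1) => mem_iUnion.1 a.2
          exact ⟨t.sup r, fun a ha => hS.monotone (Finset.le_sup ha) (hr a)⟩
        obtain ⟨k, hk⟩ := ht
        obtain ⟨c, hc⟩ := hC
        obtain ⟨b, -, hb⟩ := (S k).2.2 ⊤ ⟨c, Formula.realize_top.2 trivial, hc⟩ I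
        exact ⟨b, fun a ha => hb a.1 (hk a ha)⟩)
    exact ⟨b, fun a ha => hb ⟨a, ha⟩⟩

end ModelTheory

end PhiTypes

theorem mainTheorem5
    {L : FirstOrder.Language.{u, v}} (hL : L.card ≤ ℵ₀) (T : L.Theory)
    {U : Type w} [L.Structure U] (hT : U ⊨ T)
    {κ : Cardinal.{w}} (hκ : ℵ₀ < κ) (hU : PhiTypes.IsMonster L U κ)
    (M : L.ElementarySubstructure U) (hM : Countable M)
    {m n : ℕ} (φ : L.Formula (Fin m ⊕ Fin n)) (hφ : PhiTypes.IsNIP U φ)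
    (F : Set (PhiTypes.Inv φ M)) (hF : IsClosed F) :
    Dense {p : F | IsGδ ({p} : Set F)} := by
  have : Countable L.Symbols := mk_le_aleph0_iff.1 hL
  have : Nonempty (L.Formula (M ⊕ Fin n)) := ⟨⊤⟩
  obtain ⟨ψ, hψ⟩ := exists_surjective_nat (L.Formula (M ⊕ Fin n))
  have : CompactSpace F := isCompact_iff_compactSpace.1 hF.isCompact
  refine PhiTypes.dense_isGδ_singleton
    (e := fun (p : F) (b : Fin n → U) => PhiTypes.inst φ b ∈ p.1.1.formulas)
    (fun p q h => Subtype.ext (Subtype.ext (PhiTypes.GlobalType.ext_inst fun b =>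
      iff_of_eq (congrFun h b))))
    (fun b => (PhiTypes.GlobalType.isClopen_inst_mem b).preimage
      (continuous_subtype_val.comp continuous_subtype_val))
    (fun i => PhiTypes.defSet M (ψ i)) (fun p C hC => ?_)
  obtain ⟨θ, hθ⟩ := p.1.2.exists_constant hU hκ hφ hC
  obtain ⟨i, rfl⟩ := hψ θ
  exact ⟨i, hθ⟩
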